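/- Let $q_0\in\mathbb C^2$ and let $S,A,B$ be germs at $q_0$ of holomorphic functions of $(x,y)$ such that the discriminant $D$ of $T^3+ST^2+AT+B$ with respect to $T$ does not vanish identically. Consider the solution web of the implicit ODE $$p^3+S(x,y)p^2+A(x,y)p+B(x,y)=0,\qquad p=\frac{dy}{dx}.$$ At points with $D\neq0$ let $p_1,p_2,p_3$ denote the (locally holomorphic, locally numbered) roots and put $$\sigma_1=(p_2-p_3)(dy-p_1dx),\quad \sigma_2=(p_3-p_1)(dy-p_2dx),\quad \Omega=\sigma_1\wedge\sigma_2,\quad d\sigma_i=h_i\Omega,\quad \gamma=h_2\sigma_1-h_1\sigma_2 ;$$ $\gamma$ is the Chern connection form. Suppose that: 1. for some $w_x,w_y\in\mathbb C$ with $w_x\ne w_y$ the vector field $X=w_xx\,\partial_x+w_yy\,\partial_y$ is an infinitesimal symmetry of the web, i.e. near $q_0$, at points with $D\ne0$, each $[X,\partial_x+p_i\partial_y]$ is a multiple of $\partial_x+p_i\partial_y$; 2. the Chern connection form vanishes identically, $\gamma=0$; 3. on $\mathbb C^3$ with coordinates $(t,x,y)$ the vector fields $e_1=\alpha\partial_t+v_1$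 and $e_2=\beta\partial_t+v_2$ commute, where $$v_1=\frac{-(\partial_x+p_1\partial_y)}{(p_3-p_1)(p_1-p_2)},\quad v_2=\frac{-(\partial_x+p_2\partial_y)}{(p_1-p_2)(p_2-p_3)},$$ $$\alpha=\frac{p_2p_3-p_1(p_2+p_3)}{2(p_1-p_2)(p_1-p_3)},\quad \beta=\frac{p_1p_3-p_2(p_1+p_3)}{2(p_2-p_1)(p_2-p_3)}.$$ Then there is a germ of a Frobenius $3$-fold $M$ with $\langle e,e\rangle=0$ whose booklet web is this solution web, and whose Euler field projects along $e$ onto $X$. Here a Frobenius manifold is a complex manifold with a holomorphic commutative associative multiplication on tangent spaces, a holomorphic flat non-degenerate symmetric inner product with $\langle u\cdot v,w\rangle=\langle u,v\cdot w\rangle$ and Levi-Civita connection $\nabla$, a unity field $e$ with $\nabla e=0$, and an Euler field $E$ with $\nabla\nabla E=0$ along which the Lie derivatives of the multiplication and of the inner product are constant multiples of them, such that $(\nabla_zc)(u,v,w)$, $c(u,v,w)=\langle u\cdot v,w\rangle$, is symmetric in $u,v,w,z$. That the booklet web is the solution web means: there is an immersed surface germ $\varphi:(\mathbb C^2,q_0)\to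 M$ transverse to $e$ such that, for all $q$ near $q_0$, the algebra $T_{\varphi(q)}M$ is semi-simple (has a basis of idempotents $e_1,e_2,e_3$ with $e_i\cdot e_j=\delta_{ij}e_i$) if and only if $D(q)\ne0$, and in that case the three directions cut on the surface by the planes $\mathrm{span}\{e,e_i\}$ are exactly the directions $[1:p_i]$. That $E$ projects onto $X$ means $E(\varphi(q))-d\varphi_q(X(q))\in\mathbb C\,e$ for $q$ near $q_0$. -/

import Mathlib

open Filter Topology

noncomputable section

/-! ## Frobenius manifolds (in a chart) -/

/-- The covariant derivative `v ↦ ∇_v Y` of a vector field `Y` for the connection with Christoffel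
tensor `Γ`, as an endomorphism of the tangent space at `z`. -/
def covariantDerivative {V : Type*} [NormedAddCommGroup V] [NormedSpace ℂ V]
    (Γ : V → V →L[ℂ] V →L[ℂ] V) (Y : V → V) (z : V) : V →L[ℂ] V :=
  fderiv ℂ Y z + (Γ z).flip (Y z)

/-- The covariant derivative `(∇_s c)(u, v, w)` of the `3`-tensor `c(u, v, w) = ⟨u · v, w⟩`. -/
def nablaProductTensor {V : Type*} [NormedAddCommGroup V] [NormedSpace ℂ V]
    (mul : V → V →L[ℂ] V →L[ℂ] V) (metric : V → V →L[ℂ] V →L[ℂ] ℂ)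
    (Γ : V → V →L[ℂ] V →L[ℂ] V) (z s u v w : V) : ℂ :=
  fderiv ℂ (fun z' => metric z' (mul z' u v) w) z s
    - metric z (mul z (Γ z s u) v) w
    - metric z (mul z u (Γ z s v)) w
    - metric z (mul z u v) (Γ z s w)

/-- The structure of a Frobenius manifold on an open subset `U` of a complex vector space
`V` (germs of complex manifolds are germs of such open subsets). The metric is an arbitrary
holomorphic symmetric bilinear form, it is not assumed to be written in flat coordinates.
`christoffel` is the Christoffel tensor of the Levi-Civita connection, which is determined by
`torsion_free` and `metric_compatible`. -/
structure FrobeniusStructure {V : Type*} [NormedAddCommGroup V] [NormedSpace ℂ V]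
    (U : Set V) where
  /-- the multiplication on tangent spaces -/
  mul : V → V →L[ℂ] V →L[ℂ] V
  /-- the inner product on tangent spaces -/
  metric : V → V →L[ℂ] V →L[ℂ] ℂ
  /-- the Levi-Civita connection `∇_u Y = dY(u) + Γ(u, Y)` -/
  christoffel : V → V →L[ℂ] V →L[ℂ] V
  /-- the unity vector field `e` -/
  unit : V → V
  /-- the Euler vector field `E` -/
  euler : V → V
  isOpen : IsOpen U
  mul_analytic : AnalyticOnNhd ℂ mul U
  metric_analytic : AnalyticOnNhd ℂ metric U
  christoffel_analytic : AnalyticOnNhd ℂ christoffel U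
  unit_analytic : AnalyticOnNhd ℂ unit U
  euler_analytic : AnalyticOnNhd ℂ euler U
  mul_comm : ∀ z ∈ U, ∀ u v, mul z u v = mul z v u
  mul_assoc : ∀ z ∈ U, ∀ u v w, mul z (mul z u v) w = mul z u (mul z v w)
  metric_symm : ∀ z ∈ U, ∀ u v, metric z u v = metric z v u
  metric_nondegenerate : ∀ z ∈ U, ∀ u, (∀ v, metric z u v = 0) → u = 0
  metric_invariant : ∀ z ∈ U, ∀ u v w, metric z (mul z u v) w = metric z u (mul z v w)
  torsion_free : ∀ z ∈ U, ∀ u v, christoffel z u v = christoffel z v u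
  metric_compatible : ∀ z ∈ U, ∀ u v w,
    fderiv ℂ metric z u v w
      = metric z (christoffel z u v) w + metric z v (christoffel z u w)
  /-- the curvature tensor of the Levi-Civita connection vanishes -/
  flat : ∀ z ∈ U, ∀ u v w,
    fderiv ℂ christoffel z u v w - fderiv ℂ christoffel z v u w
      + christoffel z u (christoffel z v w) - christoffel z v (christoffel z u w) = 0
  unit_mul : ∀ z ∈ U, ∀ v, mul z (unit z) v = v
  /-- `∇ e = 0` -/
  unit_parallel : ∀ z ∈ U, covariantDerivative christoffel unit z = 0
  /-- `∇ (∇ E) = 0`, that is `∇_u (A v) = A (∇_u v)` for the endomorphism field `A = ∇ E` -/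
  euler_linear : ∀ z ∈ U, ∀ u v,
    fderiv ℂ (covariantDerivative christoffel euler) z u v
      + christoffel z u (covariantDerivative christoffel euler z v)
      - covariantDerivative christoffel euler z (christoffel z u v) = 0
  /-- the flow of `E` re-scales the multiplication: its Lie derivative along `E` is a constant
  multiple of it -/
  euler_mul : ∃ k : ℂ, ∀ z ∈ U, ∀ u v,
    fderiv ℂ mul z (euler z) u v - fderiv ℂ euler z (mul z u v)
      + mul z (fderiv ℂ euler z u) v + mul z u (fderiv ℂ euler z v) = k • mul z u v
  /-- the flow of `E` re-scales the inner product: its Lie derivative along `E` is a constant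
  multiple of it -/
  euler_metric : ∃ k : ℂ, ∀ z ∈ U, ∀ u v,
    fderiv ℂ metric z (euler z) u v
      + metric z (fderiv ℂ euler z u) v + metric z u (fderiv ℂ euler z v) = k • metric z u v
  /-- the `4`-tensor `(∇_s c)(u, v, w)` with `c(u, v, w) = ⟨u · v, w⟩` is symmetric in
  `s, u, v, w` (invariance under the three adjacent transpositions) -/
  potential : ∀ z ∈ U, ∀ s u v w,
    nablaProductTensor mul metric christoffel z s u v w
        = nablaProductTensor mul metric christoffel z u s v w ∧
    nablaProductTensor mul metric christoffel z s u v w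
        = nablaProductTensor mul metric christoffel z s v u w ∧
    nablaProductTensor mul metric christoffel z s u v w
        = nablaProductTensor mul metric christoffel z s u w v

/-- `e 0, e 1, e 2` split the tangent algebra at `z` of a Frobenius `3`-fold into a direct product
of one-dimensional algebras: they form a basis with `e i · e j = δ i j • e i`. -/
def FrobeniusStructure.IsIdempotentFrame {U : Set (ℂ × ℂ × ℂ)} (F : FrobeniusStructure U)
    (z : ℂ × ℂ × ℂ) (e : Fin 3 → ℂ × ℂ × ℂ) : Prop :=
  LinearIndependent ℂ e ∧ ∀ i j, F.mul z (e i) (e j) = if i = j then e i else 0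

/-- The tangent algebra at `z` of a Frobenius `3`-fold is semi-simple. -/
def FrobeniusStructure.IsSemisimpleAt {U : Set (ℂ × ℂ × ℂ)} (F : FrobeniusStructure U)
    (z : ℂ × ℂ × ℂ) : Prop :=
  ∃ e : Fin 3 → ℂ × ℂ × ℂ, F.IsIdempotentFrame z e

/-! ## The solution web of a monic cubic implicit ODE -/

/-- The cubic polynomial `T ^ 3 + S T ^ 2 + A T + B` at the point `q` of the plane. -/
def odeCubic (S A B : ℂ × ℂ → ℂ) (q : ℂ × ℂ) : Cubic ℂ := ⟨1, S q, A q, B q⟩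

/-- The nonzero tangent vector `v = (dx, dy)` at `q` is a web direction of
`p ^ 3 + S p ^ 2 + A p + B = 0`, where `p = dy / dx`. -/
def IsSolutionDirection (S A B : ℂ × ℂ → ℂ) (q v : ℂ × ℂ) : Prop :=
  v ≠ 0 ∧ v.2 ^ 3 + S q * v.2 ^ 2 * v.1 + A q * v.2 * v.1 ^ 2 + B q * v.1 ^ 3 = 0

/-- `p 0, p 1, p 2` is a numbering of the roots of the cubic, near a point `q` at which
they are pairwise distinct, by holomorphic functions. -/
def IsRootNumbering (S A B : ℂ × ℂ → ℂ) (q : ℂ × ℂ) (p : Fin 3 → ℂ × ℂ → ℂ) : Prop :=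
  (∀ i, AnalyticAt ℂ (p i) q) ∧
  (∀ᶠ z in 𝓝 q, ∀ T : ℂ,
    T ^ 3 + S z * T ^ 2 + A z * T + B z = (T - p 0 z) * (T - p 1 z) * (T - p 2 z)) ∧
  Function.Injective fun i => p i q

/-- The vector field `X` is an infinitesimal symmetry of the germ at `q₀` of the solution web:
the Lie bracket of `X` with the web direction fields `∂_x + p ∂_y` is tangent to the web leaves. -/
def IsInfinitesimalSymmetry (S A B : ℂ × ℂ → ℂ) (q₀ : ℂ × ℂ) (X : ℂ × ℂ → ℂ × ℂ) : Prop :=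
  ∀ᶠ q in 𝓝 q₀, ∀ p, IsRootNumbering S A B q p → ∀ i,
    ∃ c : ℂ, VectorField.lieBracket ℂ X (fun z => (1, p i z)) q = c • (1, p i q)

/-- The dilatation `w_x x ∂_x + w_y y ∂_y`. -/
def dilatation (wx wy : ℂ) (q : ℂ × ℂ) : ℂ × ℂ := (wx * q.1, wy * q.2)

/-- The `1`-form `(b - c) (dy - a dx)`. -/
def webForm (a b c : ℂ × ℂ → ℂ) (q : ℂ × ℂ) : ℂ × ℂ →L[ℂ] ℂ :=
  (b q - c q) • (ContinuousLinearMap.snd ℂ ℂ ℂ - a q • ContinuousLinearMap.fst ℂ ℂ ℂ)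

/-- The exterior derivative of a `1`-form on the plane. -/
def exteriorDerivative (σ : ℂ × ℂ → ℂ × ℂ →L[ℂ] ℂ) (q u v : ℂ × ℂ) : ℂ :=
  fderiv ℂ σ q u v - fderiv ℂ σ q v u

/-- The wedge product of two `1`-forms on the plane. -/
def wedge (σ τ : ℂ × ℂ → ℂ × ℂ →L[ℂ] ℂ) (q u v : ℂ × ℂ) : ℂ :=
  σ q u * τ q v - σ q v * τ q u

/-- The function `h` with `dσ = h Ω`, for a nowhere vanishing `2`-form `Ω`. -/
def formQuotient (σ : ℂ × ℂ → ℂ × ℂ →L[ℂ] ℂ) (Ω : ℂ × ℂ → ℂ × ℂ → ℂ × ℂ → ℂ)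
    (q : ℂ × ℂ) : ℂ :=
  exteriorDerivative σ q (1, 0) (0, 1) / Ω q (1, 0) (0, 1)

/-- The Chern connection form `γ = h₁ σ₀ - h₀ σ₁`, where
`σ₀ = (p₁ - p₂)(dy - p₀ dx)`, `σ₁ = (p₂ - p₀)(dy - p₁ dx)`, `Ω = σ₀ ∧ σ₁` and `dσᵢ = hᵢ Ω`. -/
def chernForm (p : Fin 3 → ℂ × ℂ → ℂ) (q : ℂ × ℂ) : ℂ × ℂ →L[ℂ] ℂ :=
  let σ₀ := webForm (p 0) (p 1) (p 2)
  let σ₁ := webForm (p 1) (p 2) (p 0)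
  let Ω := wedge σ₀ σ₁
  formQuotient σ₁ Ω q • σ₀ q - formQuotient σ₀ Ω q • σ₁ q

/-- The vector field `f ∂_t + K (∂_x + a ∂_y) / ((c - a) (a - b))` on `ℂ³`, with coordinates
`(t, x, y)`, where `K = -1` and `f = (b c - a (b + c)) / (2 (a - b) (a - c))`. -/
def idempotentField (a b c : ℂ × ℂ → ℂ) (z : ℂ × ℂ × ℂ) : ℂ × ℂ × ℂ :=
  let q := z.2
  let f := (b q * c q - a q * (b q + c q)) / (2 * (a q - b q) * (a q - c q))
  let K : ℂ := -1
  let k := K / ((c q - a q) * (a q - b q))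
  (f, k, k * a q)

/-! ## Booklet webs -/

/-- The germ at `q₀` of the solution web of `p ^ 3 + S p ^ 2 + A p + B = 0` is the booklet web cut
by the Frobenius `3`-fold `F` on the surface germ parametrized by `φ`. The surface is
transverse to the unity field `e`; the tangent algebra is semi-simple exactly over the regular
points of the solution web, and there the directions cut on the surface by the three planes
spanned by `e` and `e i` are exactly the three directions of the solution web.
(If the discriminant of the cubic does not vanish identically, this also determines, by
continuity, the directions with multiplicity at the singular points.) -/
def IsBookletWeb {U : Set (ℂ × ℂ × ℂ)} (F : FrobeniusStructure U) (φ : ℂ × ℂ → ℂ × ℂ × ℂ)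
    (S A B : ℂ × ℂ → ℂ) (q₀ : ℂ × ℂ) : Prop :=
  φ q₀ ∈ U ∧ AnalyticAt ℂ φ q₀ ∧
  Function.Injective (fderiv ℂ φ q₀) ∧ F.unit (φ q₀) ∉ Set.range (fderiv ℂ φ q₀) ∧
  ∀ᶠ q in 𝓝 q₀,
    (F.IsSemisimpleAt (φ q) ↔ (odeCubic S A B q).discr ≠ 0) ∧
    ∀ e, F.IsIdempotentFrame (φ q) e → ∀ v : ℂ × ℂ,
      (v ≠ 0 ∧ ∃ i, fderiv ℂ φ q v ∈ Submodule.span ℂ {F.unit (φ q), e i}) ↔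
        IsSolutionDirection S A B q v

end

/-! The manifold is constructed explicitly as `ℂ × W`, for a ball `W` around `q₀`, with flat
coordinates `(t, x, y)`, metric `2 dt dx + dy ^ 2` and unity `∂_t`. The tangent algebra over `q` is
`ℂ[T]` modulo the cubic at `q`, with `∂_y` the class of `T` and `∂_x` that of `T ^ 2 + S T + A / 2`.
Its structure constants are polynomials in `S`, `A`, `B`, so it stays holomorphic where roots
collide.

Where the roots `p_i` are distinct, the idempotent equal to `1` at `p_i` and `0` at the other two
roots is a multiple of `∂_x + p_i ∂_y` plus a multiple of `∂_t`. These are the fields `e_i` of the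
hypothesis, and the surface `t = 0` therefore cuts out the web
(`IsCubicIdempotentFrame.mem_span_iff`). The algebra is semi-simple exactly when the discriminant is
nonzero (`exists_isCubicIdempotentFrame_iff`).

The remaining axioms are differential equations for the coefficients. Symmetry of `∇c` amounts to
three first-order equations for `S`, `A`, `B`. They follow from the three components of `[e_1, e_2]
= 0`, which are linear in the derivatives of the roots (`derivatives_of_commuting`,
`coefficient_derivatives`). The infinitesimal symmetry makes each root homogeneous of weight `wy -
wx`, hence `S`, `A`, `B` of weights `1`, `2`, `3` times that, and a linear diagonal field is then an
Euler field.

All this is obtained where the discriminant is nonzero. The identity theorem and continuity extend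
it to `W` (`eq_zero_of_forall_ne_zero`), and `cubicFrobenius` assembles the structure. -/

noncomputable section

/-! ### The Frobenius structure in flat coordinates -/

/-- The bilinear map `(u, v) ↦ α u * β v • w`. -/
def rankOneBilinear {V : Type*} [NormedAddCommGroup V] [NormedSpace ℂ V]
    (α β : V →L[ℂ] ℂ) (w : V) : V →L[ℂ] V →L[ℂ] V :=
  α.smulRight (β.smulRight w)

@[simp]
theorem rankOneBilinear_apply {V : Type*} [NormedAddCommGroup V] [NormedSpace ℂ V]
    (α β : V →L[ℂ] ℂ) (w u v : V) : rankOneBilinear α β w u v = α u • β v • w := by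
  simp [rankOneBilinear]

/-- The coordinate form `dt` on `ℂ³` with coordinates `(t, x, y)`. -/
def coordT : ℂ × ℂ × ℂ →L[ℂ] ℂ := ContinuousLinearMap.fst ℂ ℂ (ℂ × ℂ)

/-- The coordinate form `dx` on `ℂ³`. -/
def coordX : ℂ × ℂ × ℂ →L[ℂ] ℂ :=
  (ContinuousLinearMap.fst ℂ ℂ ℂ).comp (ContinuousLinearMap.snd ℂ ℂ (ℂ × ℂ))

/-- The coordinate form `dy` on `ℂ³`. -/
def coordY : ℂ × ℂ × ℂ →L[ℂ] ℂ :=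
  (ContinuousLinearMap.snd ℂ ℂ ℂ).comp (ContinuousLinearMap.snd ℂ ℂ (ℂ × ℂ))

@[simp] theorem coordT_apply (u : ℂ × ℂ × ℂ) : coordT u = u.1 := rfl
@[simp] theorem coordX_apply (u : ℂ × ℂ × ℂ) : coordX u = u.2.1 := rfl
@[simp] theorem coordY_apply (u : ℂ × ℂ × ℂ) : coordY u = u.2.2 := rfl

/-- The metric `2 dt dx + dy ^ 2`. -/
def flatMetric : ℂ × ℂ × ℂ →L[ℂ] ℂ × ℂ × ℂ →L[ℂ] ℂ :=
  coordT.smulRight coordX + coordX.smulRight coordT + coordY.smulRight coordY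

@[simp]
theorem flatMetric_apply (u v : ℂ × ℂ × ℂ) :
    flatMetric u v = u.1 * v.2.1 + u.2.1 * v.1 + u.2.2 * v.2.2 := by
  simp [flatMetric]

/-- The part of the multiplication `cubicMul` that depends neither on the point nor on the cubic. -/
def cubicMulConst : ℂ × ℂ × ℂ →L[ℂ] ℂ × ℂ × ℂ →L[ℂ] ℂ × ℂ × ℂ :=
  rankOneBilinear coordT coordT (1, 0, 0)
    + rankOneBilinear coordT coordX (0, 1, 0) + rankOneBilinear coordX coordT (0, 1, 0)
    + rankOneBilinear coordT coordY (0, 0, 1) + rankOneBilinear coordY coordT (0, 0, 1)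
    + rankOneBilinear coordY coordY (0, 1, 0)

/-- The part of the multiplication that is linear in the third derivatives `s`, `a`, `b`, `d`
of the potential. -/
def cubicMulLinear (s a b d : ℂ) : ℂ × ℂ × ℂ →L[ℂ] ℂ × ℂ × ℂ →L[ℂ] ℂ × ℂ × ℂ :=
  s • rankOneBilinear coordY coordY (0, 0, -1)
    + a • (rankOneBilinear coordY coordY (-1 / 2, 0, 0)
      + rankOneBilinear coordX coordY (0, 0, -1 / 2) + rankOneBilinear coordY coordX (0, 0, -1 / 2))
    + b • (rankOneBilinear coordX coordX (0, 0, -1)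
      + rankOneBilinear coordX coordY (-1, 0, 0) + rankOneBilinear coordY coordX (-1, 0, 0))
    + d • rankOneBilinear coordX coordX (1, 0, 0)

/-- The multiplication on `ℂ³` with unity `∂_t` for which `Y = ∂_y` is a root of
`T ^ 3 + s T ^ 2 + a T + b` and `∂_x = Y ^ 2 + s Y + a / 2`. -/
def cubicMul (s a b : ℂ) : ℂ × ℂ × ℂ →L[ℂ] ℂ × ℂ × ℂ →L[ℂ] ℂ × ℂ × ℂ :=
  cubicMulConst + cubicMulLinear s a b (a ^ 2 / 4 - s * b)

theorem cubicMulLinear_apply (s a b d : ℂ) (u v : ℂ × ℂ × ℂ) :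
    cubicMulLinear s a b d u v =
      (-b * (u.2.1 * v.2.2 + u.2.2 * v.2.1) - a / 2 * (u.2.2 * v.2.2) + d * (u.2.1 * v.2.1),
        0, -s * (u.2.2 * v.2.2) - a / 2 * (u.2.1 * v.2.2 + u.2.2 * v.2.1)
          - b * (u.2.1 * v.2.1)) := by
  ext <;> simp [cubicMulLinear] <;> ring

theorem cubicMul_apply (s a b : ℂ) (u v : ℂ × ℂ × ℂ) :
    cubicMul s a b u v =
      (u.1 * v.1 - b * (u.2.1 * v.2.2 + u.2.2 * v.2.1) - a / 2 * (u.2.2 * v.2.2)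
          + (a ^ 2 / 4 - s * b) * (u.2.1 * v.2.1),
        u.1 * v.2.1 + u.2.1 * v.1 + u.2.2 * v.2.2,
        u.1 * v.2.2 + u.2.2 * v.1 - s * (u.2.2 * v.2.2)
          - a / 2 * (u.2.1 * v.2.2 + u.2.2 * v.2.1) - b * (u.2.1 * v.2.1)) := by
  ext <;> simp [cubicMul, cubicMulLinear_apply, cubicMulConst] <;> ring

/-- The diagonal endomorphism `(t, x, y) ↦ (k t, w_x x, w_y y)`. -/
def diagonalMap (k wx wy : ℂ) : ℂ × ℂ × ℂ →L[ℂ] ℂ × ℂ × ℂ :=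
  (k • coordT).prod ((wx • coordX).prod (wy • coordY))

@[simp]
theorem diagonalMap_apply (k wx wy : ℂ) (u : ℂ × ℂ × ℂ) :
    diagonalMap k wx wy u = (k * u.1, wx * u.2.1, wy * u.2.2) := by
  simp [diagonalMap]

/-- `cubicMulLinear` as a continuous linear map of the coefficients. -/
def cubicMulLinearCLM :
    ℂ × ℂ × ℂ × ℂ →L[ℂ] ℂ × ℂ × ℂ →L[ℂ] ℂ × ℂ × ℂ →L[ℂ] ℂ × ℂ × ℂ :=
  LinearMap.toContinuousLinearMap
    { toFun := fun c => cubicMulLinear c.1 c.2.1 c.2.2.1 c.2.2.2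
      map_add' := fun c c' => by
        refine ContinuousLinearMap.ext fun u => ContinuousLinearMap.ext fun v => ?_
        simp only [add_apply, cubicMulLinear_apply]
        ext <;> simp <;> ring
      map_smul' := fun k c => by
        refine ContinuousLinearMap.ext fun u => ContinuousLinearMap.ext fun v => ?_
        simp only [smul_apply, cubicMulLinear_apply]
        ext <;> simp <;> ring }

theorem cubicMulLinearCLM_apply (c : ℂ × ℂ × ℂ × ℂ) :
    cubicMulLinearCLM c = cubicMulLinear c.1 c.2.1 c.2.2.1 c.2.2.2 := rfl

/-- The multiplication is a constant plus a linear function of `(S, A, B, A ^ 2 / 4 - S B)`. Keeping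
the last entry as an independent slot `d` makes differentiation act slot by slot. -/
theorem fderiv_cubicMul {S A B : ℂ × ℂ → ℂ} {z : ℂ × ℂ × ℂ}
    (hS : DifferentiableAt ℂ S z.2) (hA : DifferentiableAt ℂ A z.2)
    (hB : DifferentiableAt ℂ B z.2) (s : ℂ × ℂ × ℂ) :
    DifferentiableAt ℂ (fun z => cubicMul (S z.2) (A z.2) (B z.2)) z ∧
    fderiv ℂ (fun z => cubicMul (S z.2) (A z.2) (B z.2)) z s =
      cubicMulLinear (fderiv ℂ S z.2 s.2) (fderiv ℂ A z.2 s.2) (fderiv ℂ B z.2 s.2)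
        (A z.2 * fderiv ℂ A z.2 s.2 / 2 - fderiv ℂ S z.2 s.2 * B z.2
          - S z.2 * fderiv ℂ B z.2 s.2) := by
  have h2 : HasFDerivAt (fun z : ℂ × ℂ × ℂ => z.2) (ContinuousLinearMap.snd ℂ ℂ (ℂ × ℂ)) z :=
    hasFDerivAt_snd
  have hS' := hS.hasFDerivAt.comp z h2
  have hA' := hA.hasFDerivAt.comp z h2
  have hB' := hB.hasFDerivAt.comp z h2
  have hd := ((hA'.pow 2).mul_const (1 / 4)).sub (hS'.mul hB')
  have H := (cubicMulLinearCLM.hasFDerivAt.comp z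
    (hS'.prodMk (hA'.prodMk (hB'.prodMk hd)))).const_add cubicMulConst
  have H' := H.congr_of_eventuallyEq (f₁ := fun z => cubicMul (S z.2) (A z.2) (B z.2))
    (Eventually.of_forall fun z => by
      simp [cubicMul, cubicMulLinearCLM_apply, div_eq_mul_inv])
  refine ⟨H'.differentiableAt, ?_⟩
  rw [H'.fderiv]
  simp only [ContinuousLinearMap.comp_apply, cubicMulLinearCLM_apply]
  congr 1
  simp
  ring

/-- The Frobenius `3`-fold in flat coordinates `(t, x, y)` with metric `2 dt dx + dy ^ 2`, unity
`∂_t` and multiplication `cubicMul`. -/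
def cubicFrobenius (S A B : ℂ × ℂ → ℂ) (wx wy : ℂ) (W : Set (ℂ × ℂ)) (hW : IsOpen W)
    (hS : AnalyticOnNhd ℂ S W) (hA : AnalyticOnNhd ℂ A W) (hB : AnalyticOnNhd ℂ B W)
    -- Here `c(∂_y, ∂_y, ∂_y) = -S`, `c(∂_x, ∂_y, ∂_y) = -A / 2`, `c(∂_x, ∂_x, ∂_y) = -B` and
    -- `c(∂_x, ∂_x, ∂_x) = A ^ 2 / 4 - S B`. The next three equations are the compatibility
    -- conditions for these to be third derivatives of a potential.
    (hSA : ∀ q ∈ W, 2 * fderiv ℂ S q (1, 0) = fderiv ℂ A q (0, 1))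
    (hAB : ∀ q ∈ W, fderiv ℂ A q (1, 0) = 2 * fderiv ℂ B q (0, 1))
    (hBd : ∀ q ∈ W, -fderiv ℂ B q (1, 0) = A q * fderiv ℂ A q (0, 1) / 2
      - fderiv ℂ S q (0, 1) * B q - S q * fderiv ℂ B q (0, 1))
    (hXS : ∀ q ∈ W, fderiv ℂ S q (dilatation wx wy q) = (wy - wx) * S q)
    (hXA : ∀ q ∈ W, fderiv ℂ A q (dilatation wx wy q) = 2 * (wy - wx) * A q)
    (hXB : ∀ q ∈ W, fderiv ℂ B q (dilatation wx wy q) = 3 * (wy - wx) * B q) :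
    FrobeniusStructure (Prod.snd ⁻¹' W : Set (ℂ × ℂ × ℂ)) where
  mul z := cubicMul (S z.2) (A z.2) (B z.2)
  metric _ := flatMetric
  christoffel _ := 0
  unit _ := (1, 0, 0)
  -- The weight of `t` is forced by the metric: `dt dx` must have the same weight `2 * wy` as `dy ^
  -- 2`.
  euler := diagonalMap (2 * wy - wx) wx wy
  isOpen := hW.preimage continuous_snd
  mul_analytic z hz := by
    have hS' : AnalyticAt ℂ (fun z : ℂ × ℂ × ℂ => S z.2) z := (hS z.2 hz).comp analyticAt_snd
    have hA' : AnalyticAt ℂ (fun z : ℂ × ℂ × ℂ => A z.2) z := (hA z.2 hz).comp analyticAt_snd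
    have hB' : AnalyticAt ℂ (fun z : ℂ × ℂ × ℂ => B z.2) z := (hB z.2 hz).comp analyticAt_snd
    have h := (ContinuousLinearMap.analyticAt (F := ℂ × ℂ × ℂ →L[ℂ] ℂ × ℂ × ℂ →L[ℂ] ℂ × ℂ × ℂ)
      cubicMulLinearCLM
      (S z.2, A z.2, B z.2, A z.2 ^ 2 / 4 - S z.2 * B z.2)).comp
        (f := fun z : ℂ × ℂ × ℂ => (S z.2, A z.2, B z.2, A z.2 ^ 2 / 4 - S z.2 * B z.2))
        (hS'.prod (hA'.prod (hB'.prod (((hA'.pow 2).div_const).sub (hS'.mul hB')))))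
    exact analyticAt_const.add h
  metric_analytic _ _ := analyticAt_const
  christoffel_analytic _ _ := analyticAt_const
  unit_analytic _ _ := analyticAt_const
  euler_analytic _ _ := (diagonalMap _ _ _).analyticAt _
  mul_comm z _ u v := by
    simp only [cubicMul_apply]; ext <;> simp only <;> ring
  mul_assoc z _ u v w := by
    -- This works because the coefficient `a ^ 2 / 4 - s * b` in `∂_x · ∂_x` is the one obtained by
    -- reducing `(T ^ 2 + s T + a / 2) ^ 2` modulo the cubic.
    simp only [cubicMul_apply]; ext <;> simp only <;> ring
  metric_symm z _ u v := by simp only [flatMetric_apply]; ring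
  metric_nondegenerate z _ u h := by
    have h1 := h (1, 0, 0)
    have h2 := h (0, 1, 0)
    have h3 := h (0, 0, 1)
    simp at h1 h2 h3
    ext <;> simp [h1, h2, h3]
  metric_invariant z _ u v w := by simp only [cubicMul_apply, flatMetric_apply]; ring
  torsion_free z _ u v := by simp
  metric_compatible z _ u v w := by simp
  flat z _ u v w := by simp
  unit_mul z _ v := by simp [cubicMul_apply]
  unit_parallel z _ := by
    ext <;> simp [covariantDerivative]
  euler_linear z _ u v := by
    have : covariantDerivative (fun _ => 0) (diagonalMap (2 * wy - wx) wx wy)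
        = fun _ => diagonalMap (2 * wy - wx) wx wy := by
      funext z
      ext <;> simp [covariantDerivative]
    simp [this]
  euler_mul := by
    refine ⟨2 * wy - wx, fun z hz u v => ?_⟩
    have hE : (diagonalMap (2 * wy - wx) wx wy z).2 = dilatation wx wy z.2 := by
      simp [dilatation]
    rw [(fderiv_cubicMul (hS _ hz).differentiableAt (hA _ hz).differentiableAt
      (hB _ hz).differentiableAt _).2, hE, hXS _ hz, hXA _ hz, hXB _ hz]
    simp only [ContinuousLinearMap.fderiv, cubicMulLinear_apply, cubicMul_apply,
      diagonalMap_apply]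
    ext <;> simp <;> ring
  euler_metric := by
    refine ⟨2 * wy, fun z _ u v => ?_⟩
    simp
    ring
  potential z hz s u v w := by
    have key : ∀ s u v w, nablaProductTensor (fun z => cubicMul (S z.2) (A z.2) (B z.2))
        (fun _ => flatMetric) (fun _ => 0) z s u v w =
        flatMetric (cubicMulLinear (fderiv ℂ S z.2 s.2) (fderiv ℂ A z.2 s.2) (fderiv ℂ B z.2 s.2)
        (A z.2 * fderiv ℂ A z.2 s.2 / 2 - fderiv ℂ S z.2 s.2 * B z.2
          - S z.2 * fderiv ℂ B z.2 s.2) u v) w := by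
      intro s u v w
      obtain ⟨h1, h2⟩ := fderiv_cubicMul (hS _ hz).differentiableAt (hA _ hz).differentiableAt
        (hB _ hz).differentiableAt s
      have h3 : HasFDerivAt (fun z => flatMetric (cubicMul (S z.2) (A z.2) (B z.2) u v) w)
          ((flatMetric.flip w).comp
            (((fderiv ℂ (fun z => cubicMul (S z.2) (A z.2) (B z.2)) z).flip u).flip v)) z :=
        (flatMetric.flip w).hasFDerivAt.comp z
          ((h1.hasFDerivAt.clm_apply (hasFDerivAt_const u z)).clm_apply
            (hasFDerivAt_const v z) |>.congr_fderiv (by ext <;> simp))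
      rw [nablaProductTensor, h3.fderiv]
      simp [h2]
    have hf : ∀ (f : ℂ × ℂ → ℂ) (s : ℂ × ℂ × ℂ), fderiv ℂ f z.2 s.2
        = s.2.1 * fderiv ℂ f z.2 (1, 0) + s.2.2 * fderiv ℂ f z.2 (0, 1) := by
      intro f s
      conv_lhs => rw [show s.2 = s.2.1 • (1, 0) + s.2.2 • (0, 1) by ext <;> simp]
      simp only [map_add, map_smul, smul_eq_mul]
    have hS1 : fderiv ℂ S z.2 (1, 0) = fderiv ℂ A z.2 (0, 1) / 2 := by linear_combination hSA _ hz / 2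
    have hB1 : fderiv ℂ B z.2 (1, 0) = -(A z.2 * fderiv ℂ A z.2 (0, 1) / 2
      - fderiv ℂ S z.2 (0, 1) * B z.2 - S z.2 * fderiv ℂ B z.2 (0, 1)) := by
      linear_combination -hBd _ hz
    simp only [key, hf, flatMetric_apply, cubicMulLinear_apply, hS1, hB1, hAB _ hz]
    refine ⟨?_, ?_, ?_⟩ <;> ring

/-! ### Roots and coefficients of the cubic -/

theorem exists_eq_of_discr_ne_zero (S A B : ℂ × ℂ → ℂ) (q : ℂ × ℂ)
    (hD : (odeCubic S A B q).discr ≠ 0) :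
    ∃ a b c : ℂ, a ≠ b ∧ a ≠ c ∧ b ≠ c ∧
      S q = -(a + b + c) ∧ A q = a * b + a * c + b * c ∧ B q = -(a * b * c) := by
  have ha : (odeCubic S A B q).a ≠ 0 := one_ne_zero
  obtain ⟨a, b, c, h⟩ := (Cubic.splits_iff_roots_eq_three (φ := RingHom.id ℂ) ha).1
    (IsAlgClosed.splits _)
  have h1 := (Cubic.discr_ne_zero_iff_roots_ne ha h).1 hD
  have h2 := Cubic.eq_sum_three_roots ha h
  simp [odeCubic, Cubic.map] at h2
  refine ⟨a, b, c, h1.1, h1.2.1, h1.2.2, ?_, ?_, ?_⟩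
  · rw [h2.1]; ring
  · exact h2.2.1
  · exact h2.2.2

theorem discr_odeCubic_eq {S A B : ℂ × ℂ → ℂ} {q : ℂ × ℂ} {a b c : ℂ}
    (hS : S q = -(a + b + c)) (hA : A q = a * b + a * c + b * c) (hB : B q = -(a * b * c)) :
    (odeCubic S A B q).discr = ((a - b) * (a - c) * (b - c)) ^ 2 := by
  simp only [odeCubic, Cubic.discr, hS, hA, hB]
  ring

/-- The coefficients `(S, A, B)` of the monic cubic with the given roots. -/
def cubicOfRoots (a : ℂ × ℂ × ℂ) : ℂ × ℂ × ℂ :=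
  (-(a.1 + a.2.1 + a.2.2), a.1 * a.2.1 + a.1 * a.2.2 + a.2.1 * a.2.2, -(a.1 * a.2.1 * a.2.2))

theorem contDiff_cubicOfRoots : ContDiff ℂ ⊤ cubicOfRoots := by
  unfold cubicOfRoots
  fun_prop

theorem fderiv_cubicOfRoots_apply (a v : ℂ × ℂ × ℂ) :
    fderiv ℂ cubicOfRoots a v = (-(v.1 + v.2.1 + v.2.2),
      v.1 * (a.2.1 + a.2.2) + v.2.1 * (a.1 + a.2.2) + v.2.2 * (a.1 + a.2.1),
      -(v.1 * (a.2.1 * a.2.2) + v.2.1 * (a.1 * a.2.2) + v.2.2 * (a.1 * a.2.1))) := by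
  have h1 : HasFDerivAt (fun z : ℂ × ℂ × ℂ => z.1) coordT a := coordT.hasFDerivAt
  have h2 : HasFDerivAt (fun z : ℂ × ℂ × ℂ => z.2.1) coordX a := coordX.hasFDerivAt
  have h3 : HasFDerivAt (fun z : ℂ × ℂ × ℂ => z.2.2) coordY a := coordY.hasFDerivAt
  have H := ((h1.add h2).add h3).neg.prodMk
    ((((h1.mul h2).add (h1.mul h3)).add (h2.mul h3)).prodMk ((h1.mul h2).mul h3).neg)
  have H' : HasFDerivAt cubicOfRoots _ a := H
  rw [H'.fderiv]
  ext <;> simp <;> ring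

/-- This is the input for the inverse function theorem. Moving the roots by `(x, y, z)` changes the
polynomial to first order by `-x (T - b) (T - c) - y (T - a) (T - c) - z (T - a) (T - b)`;
evaluating at each root isolates one of `x`, `y`, `z`. -/
theorem fderiv_cubicOfRoots_injective {a b c : ℂ} (hab : a ≠ b) (hac : a ≠ c) (hbc : b ≠ c) :
    Function.Injective (fderiv ℂ cubicOfRoots (a, b, c)) := by
  rw [injective_iff_map_eq_zero]
  rintro ⟨x, y, z⟩ h
  rw [fderiv_cubicOfRoots_apply] at h
  simp only [Prod.mk_eq_zero] at h
  obtain ⟨h1, h2, h3⟩ := h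
  have ex : (a - b) * (a - c) * x = 0 := by linear_combination -a ^ 2 * h1 - a * h2 - h3
  have ey : (b - a) * (b - c) * y = 0 := by linear_combination -b ^ 2 * h1 - b * h2 - h3
  have ez : (c - a) * (c - b) * z = 0 := by linear_combination -c ^ 2 * h1 - c * h2 - h3
  simp only [mul_eq_zero, sub_eq_zero, hab, hac, hbc, hab.symm, hac.symm, hbc.symm, false_or]
    at ex ey ez
  simp [ex, ey, ez]

/-- Simple roots of a cubic depend holomorphically on the coefficients. -/
theorem exists_isRootNumbering {S A B : ℂ × ℂ → ℂ} {q : ℂ × ℂ}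
    (hS : AnalyticAt ℂ S q) (hA : AnalyticAt ℂ A q) (hB : AnalyticAt ℂ B q)
    (hD : (odeCubic S A B q).discr ≠ 0) : ∃ p, IsRootNumbering S A B q p := by
  obtain ⟨a, b, c, hab, hac, hbc, eS, eA, eB⟩ := exists_eq_of_discr_ne_zero S A B q hD
  have hinj := fderiv_cubicOfRoots_injective hab hac hbc
  let L : (ℂ × ℂ × ℂ) ≃L[ℂ] ℂ × ℂ × ℂ :=
    (LinearEquiv.ofInjectiveEndo (fderiv ℂ cubicOfRoots (a, b, c)).toLinearMap
      hinj).toContinuousLinearEquiv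
  have hcd : ContDiffAt ℂ ⊤ cubicOfRoots (a, b, c) := contDiff_cubicOfRoots.contDiffAt
  have hL : HasFDerivAt cubicOfRoots (L : (ℂ × ℂ × ℂ) →L[ℂ] ℂ × ℂ × ℂ) (a, b, c) := by
    have : (L : (ℂ × ℂ × ℂ) →L[ℂ] ℂ × ℂ × ℂ) = fderiv ℂ cubicOfRoots (a, b, c) := by
      ext <;> rfl
    rw [this]
    exact (hcd.differentiableAt (by simp)).hasFDerivAt
  let g := hcd.localInverse hL (by simp)
  have hval : cubicOfRoots (a, b, c) = (S q, A q, B q) := by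
    simp [cubicOfRoots, eS, eA, eB]
  have hgq : g (S q, A q, B q) = (a, b, c) := by
    rw [← hval]; exact hcd.localInverse_apply_image hL (by simp)
  have hg : AnalyticAt ℂ g (S q, A q, B q) := by
    rw [← hval]; exact (hcd.to_localInverse hL (by simp)).analyticAt
  have hSAB : AnalyticAt ℂ (fun z => (S z, A z, B z)) q := hS.prod (hA.prod hB)
  have hG : AnalyticAt ℂ (fun z => g (S z, A z, B z)) q := hg.fun_comp (f := fun z => (S z, A z, B z)) hSAB
  have hinv : ∀ᶠ w in 𝓝 (S q, A q, B q), cubicOfRoots (g w) = w := by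
    rw [← hval]
    exact (hcd.hasStrictFDerivAt' hL (by simp)).eventually_right_inverse
  refine ⟨![fun z => (g (S z, A z, B z)).1, fun z => (g (S z, A z, B z)).2.1,
    fun z => (g (S z, A z, B z)).2.2], ?_, ?_, ?_⟩
  · intro i
    fin_cases i
    · exact (coordT.analyticAt _).fun_comp hG
    · exact (coordX.analyticAt _).fun_comp hG
    · exact (coordY.analyticAt _).fun_comp hG
  · filter_upwards [hSAB.continuousAt.eventually hinv] with z hz T
    simp only [cubicOfRoots, Prod.mk.injEq] at hz
    simp
    obtain ⟨h1, h2, h3⟩ := hz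
    linear_combination -T ^ 2 * h1 - T * h2 - h3
  · intro i j
    fin_cases i <;> fin_cases j <;>
      simp [hgq, hab, hac, hbc, hab.symm, hac.symm, hbc.symm]

/-- The coefficients are recovered from the values of the two cubics at `T = 1, -1, 0`. -/
theorem IsRootNumbering.eventuallyEq {S A B : ℂ × ℂ → ℂ} {q : ℂ × ℂ} {p : Fin 3 → ℂ × ℂ → ℂ}
    (h : IsRootNumbering S A B q p) :
    (S =ᶠ[𝓝 q] fun z => -(p 0 z + p 1 z + p 2 z)) ∧
    (A =ᶠ[𝓝 q] fun z => p 0 z * p 1 z + p 0 z * p 2 z + p 1 z * p 2 z) ∧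
    (B =ᶠ[𝓝 q] fun z => -(p 0 z * p 1 z * p 2 z)) := by
  refine ⟨?_, ?_, ?_⟩
  · filter_upwards [h.2.1] with z hz
    linear_combination (hz 1 + hz (-1)) / 2 - hz 0
  · filter_upwards [h.2.1] with z hz
    linear_combination (hz 1 - hz (-1)) / 2
  · filter_upwards [h.2.1] with z hz
    linear_combination hz 0

theorem IsRootNumbering.fderiv_eq {S A B : ℂ × ℂ → ℂ} {q : ℂ × ℂ} {p : Fin 3 → ℂ × ℂ → ℂ}
    (h : IsRootNumbering S A B q p) (v : ℂ × ℂ) :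
    fderiv ℂ S q v = -(fderiv ℂ (p 0) q v + fderiv ℂ (p 1) q v + fderiv ℂ (p 2) q v) ∧
    fderiv ℂ A q v = fderiv ℂ (p 0) q v * (p 1 q + p 2 q) + fderiv ℂ (p 1) q v * (p 0 q + p 2 q)
      + fderiv ℂ (p 2) q v * (p 0 q + p 1 q) ∧
    fderiv ℂ B q v = -(fderiv ℂ (p 0) q v * (p 1 q * p 2 q)
      + fderiv ℂ (p 1) q v * (p 0 q * p 2 q) + fderiv ℂ (p 2) q v * (p 0 q * p 1 q)) := by
  obtain ⟨h1, h2, h3⟩ := h.eventuallyEq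
  have d := fun i => (h.1 i).differentiableAt.hasFDerivAt
  refine ⟨?_, ?_, ?_⟩
  · rw [h1.fderiv_eq]
    refine (congrArg (· v) (((d 0).add (d 1)).add (d 2)).neg.fderiv).trans ?_
    simp [add_comm, add_left_comm]
  · rw [h2.fderiv_eq]
    refine (congrArg (· v) ((((d 0).mul (d 1)).add ((d 0).mul (d 2))).add
      ((d 1).mul (d 2))).fderiv).trans ?_
    simp
    ring
  · rw [h3.fderiv_eq]
    refine (congrArg (· v) (((d 0).mul (d 1)).mul (d 2)).neg.fderiv).trans ?_
    simp
    ring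

/-! ### Differential equations from the commuting fields and the symmetry -/

/-- Restricting to the line `s ↦ z + s • v` reduces this to the one-variable quotient rule. Naming
the values and derivatives by equations lets the bracket become an identity between rational
expressions in scalars. -/
theorem fderiv_idempotentField_apply {a b c : ℂ × ℂ → ℂ} {z : ℂ × ℂ × ℂ}
    (ha : DifferentiableAt ℂ a z.2) (hb : DifferentiableAt ℂ b z.2)
    (hc : DifferentiableAt ℂ c z.2) (hab : a z.2 - b z.2 ≠ 0) (hca : c z.2 - a z.2 ≠ 0)
    (v : ℂ × ℂ × ℂ) {a₀ b₀ c₀ a' b' c' : ℂ} (ea : a z.2 = a₀) (eb : b z.2 = b₀) (ec : c z.2 = c₀)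
    (ha' : fderiv ℂ a z.2 v.2 = a') (hb' : fderiv ℂ b z.2 v.2 = b')
    (hc' : fderiv ℂ c z.2 v.2 = c') :
    fderiv ℂ (idempotentField a b c) z v =
      (((b' * c₀ + b₀ * c' - (a' * (b₀ + c₀) + a₀ * (b' + c'))) * (2 * (a₀ - b₀) * (a₀ - c₀))
          - (b₀ * c₀ - a₀ * (b₀ + c₀)) *
            (2 * (a' - b') * (a₀ - c₀) + 2 * (a₀ - b₀) * (a' - c')))
          / (2 * (a₀ - b₀) * (a₀ - c₀)) ^ 2,
        ((c' - a') * (a₀ - b₀) + (c₀ - a₀) * (a' - b')) / ((c₀ - a₀) * (a₀ - b₀)) ^ 2,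
        ((c' - a') * (a₀ - b₀) + (c₀ - a₀) * (a' - b')) / ((c₀ - a₀) * (a₀ - b₀)) ^ 2 * a₀
          - a' / ((c₀ - a₀) * (a₀ - b₀))) := by
  have hac : a z.2 - c z.2 ≠ 0 := by rw [← neg_sub]; exact neg_ne_zero.2 hca
  have hγ : HasDerivAt (fun s : ℂ => z + s • v) v 0 := by
    simpa using ((hasDerivAt_id (0 : ℂ)).smul_const v).const_add z
  have hγ2 : HasDerivAt (fun s : ℂ => (z + s • v).2) v.2 0 := by
    simpa using ((hasDerivAt_id (0 : ℂ)).smul_const v.2).const_add z.2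
  have along : ∀ f : ℂ × ℂ → ℂ, DifferentiableAt ℂ f z.2 →
      HasDerivAt (fun s : ℂ => f (z + s • v).2) (fderiv ℂ f z.2 v.2) 0 := fun f hf => by
    have h0 : HasFDerivAt f (fderiv ℂ f z.2) ((z + (0 : ℂ) • v).2) := by
      simpa using hf.hasFDerivAt
    exact h0.comp_hasDerivAt (0 : ℂ) hγ2
  have hdiff : DifferentiableAt ℂ (idempotentField a b c) z := by
    have ha1 : DifferentiableAt ℂ (fun z : ℂ × ℂ × ℂ => a z.2) z := ha.comp z differentiableAt_snd
    have hb1 : DifferentiableAt ℂ (fun z : ℂ × ℂ × ℂ => b z.2) z := hb.comp z differentiableAt_snd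
    have hc1 : DifferentiableAt ℂ (fun z : ℂ × ℂ × ℂ => c z.2) z := hc.comp z differentiableAt_snd
    unfold idempotentField
    fun_prop (disch := simp [hab, hac, hca])
  have h1 : HasDerivAt (fun s : ℂ => idempotentField a b c (z + s • v))
      (fderiv ℂ (idempotentField a b c) z v) 0 := by
    have h0 : HasFDerivAt (idempotentField a b c) (fderiv ℂ (idempotentField a b c) z)
        (z + (0 : ℂ) • v) := by simpa using hdiff.hasFDerivAt
    exact h0.comp_hasDerivAt (0 : ℂ) hγ
  have Ha := along a ha
  have Hb := along b hb
  have Hc := along c hc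
  have Hd := (Hc.sub Ha).mul (Ha.sub Hb)
  have Hk := (hasDerivAt_const (0 : ℂ) (-1 : ℂ)).div Hd (by simp [hab, hca])
  have H := (((Hb.mul Hc).sub (Ha.mul (Hb.add Hc))).div
    (((Ha.sub Hb).const_mul 2).mul (Ha.sub Hc)) (by simp [hab, hac])).prodMk
      (Hk.prodMk (Hk.mul Ha))
  rw [h1.unique H]
  subst ea eb ec ha' hb' hc'
  ext
  · simp
  · simp
  · simp
    ring

/-- The components of the relation `[e₁, e₂] = 0`, where `aᵢ` and `bᵢ` are the derivatives of the
three roots `a`, `b`, `c` along `∂_x + a ∂_y` and `∂_x + b ∂_y`. -/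
theorem derivatives_of_commuting {a b c a0 a1 a2 b0 b1 b2 : ℂ}
    (hab : a - b ≠ 0) (hbc : b - c ≠ 0) (hca : c - a ≠ 0)
    (hx : -((a0 - a1) * (b - c) + (a - b) * (a1 - a2)) / ((c - a) * (a - b))
          / ((a - b) * (b - c)) ^ 2 =
        -((b2 - b0) * (a - b) + (c - a) * (b0 - b1)) / ((a - b) * (b - c))
          / ((c - a) * (a - b)) ^ 2)
    (hy : -((a0 - a1) * (b - c) + (a - b) * (a1 - a2)) / ((c - a) * (a - b))
          / ((a - b) * (b - c)) ^ 2 * b + a1 / ((c - a) * (a - b)) / ((a - b) * (b - c)) =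
        -((b2 - b0) * (a - b) + (c - a) * (b0 - b1)) / ((a - b) * (b - c))
          / ((c - a) * (a - b)) ^ 2 * a + b0 / ((c - a) * (a - b)) / ((a - b) * (b - c)))
    (ht : -((a2 * a + c * a0 - (a1 * (c + a) + b * (a2 + a0))) * (2 * (b - c) * (b - a))
          - (c * a - b * (c + a)) * (2 * (a1 - a2) * (b - a) + 2 * (b - c) * (a1 - a0)))
          / ((c - a) * (a - b)) / (2 * (b - c) * (b - a)) ^ 2 =
        -((b1 * c + b * b2 - (b0 * (b + c) + a * (b1 + b2))) * (2 * (a - b) * (a - c))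
          - (b * c - a * (b + c)) * (2 * (b0 - b1) * (a - c) + 2 * (a - b) * (b0 - b2)))
          / ((a - b) * (b - c)) / (2 * (a - b) * (a - c)) ^ 2) :
    b0 = -a1 ∧ (a0 - b0) * (b - c) = (b - a) * (a1 - a2) ∧
      (b1 - a1) * (c - a) = (b - a) * (b0 - b2) := by
  have hba : b - a ≠ 0 := by rw [← neg_sub]; exact neg_ne_zero.2 hab
  have hac : a - c ≠ 0 := by rw [← neg_sub]; exact neg_ne_zero.2 hca
  have hX : ((a0 - a1) * (b - c) + (a - b) * (a1 - a2)) * (c - a)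
      = ((b2 - b0) * (a - b) + (c - a) * (b0 - b1)) * (b - c) := by
    linear_combination (norm := (field_simp; ring))
      (-(c - a) ^ 2 * (a - b) ^ 3 * (b - c) ^ 2) * hx
  -- Contraction with `dy - a dx`, which annihilates `e₁`, so the derivative of the scale factor of
  -- `e₁` drops out.
  have h2 : (a0 - b0) * (b - c) = (b - a) * (a1 - a2) := by
    linear_combination (norm := (field_simp; ring))
      ((c - a) * (a - b) ^ 2 * (b - c) ^ 2) * (hy - a * hx)
  have h3 : (b1 - a1) * (c - a) = (b - a) * (b0 - b2) := by
    refine mul_right_cancel₀ hbc ?_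
    linear_combination hX - (c - a) * h2
  -- The form `dt - (b c - a (b + c)) / 2 dx + c (dy - a dx)` annihilates both `e₁` and `e₂`, so
  -- contracting with it removes the derivatives of both scale factors.
  have hT : a0 * (c - b) + a1 * (c - a) + a2 * (a - b) + b0 * (b - c) + b1 * (a - c)
      + b2 * (a - b) = 0 := by
    linear_combination (norm := (field_simp; ring)) (2 * (c - a) * (a - b) ^ 2 * (b - c)) *
      (ht - (b * c - a * (b + c)) / 2 * hx + c * hy - c * a * hx)
  have h1 : b0 + a1 = 0 := by
    refine mul_left_cancel₀ hab ?_
    linear_combination hT + h2 + h3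
  exact ⟨eq_neg_of_add_eq_zero_left h1, h2, h3⟩

/-- The relations between the derivatives of the roots express the symmetry of the covariant
derivative of the multiplication. -/
theorem coefficient_derivatives {a b c x0 x1 x2 y0 y1 y2 : ℂ} (hab : a - b ≠ 0)
    (h1 : x0 + b * y0 = -(x1 + a * y1))
    (h2 : (x0 + a * y0 - (x0 + b * y0)) * (b - c) = (b - a) * (x1 + a * y1 - (x2 + a * y2)))
    (h3 : (x1 + b * y1 - (x1 + a * y1)) * (c - a) = (b - a) * (x0 + b * y0 - (x2 + b * y2))) :
    2 * -(x0 + x1 + x2) = y0 * (b + c) + y1 * (a + c) + y2 * (a + b) ∧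
    x0 * (b + c) + x1 * (a + c) + x2 * (a + b)
      = 2 * -(y0 * (b * c) + y1 * (a * c) + y2 * (a * b)) ∧
    (x0 * (b * c) + x1 * (a * c) + x2 * (a * b)) =
      (a * b + a * c + b * c) * (y0 * (b + c) + y1 * (a + c) + y2 * (a + b)) / 2
        - (y0 + y1 + y2) * (a * b * c)
        - (a + b + c) * (y0 * (b * c) + y1 * (a * c) + y2 * (a * b)) := by
  have e1 : x0 = -x1 - a * y1 - b * y0 := by linear_combination h1
  have e2 : y0 * (b - c) = -(x1 + a * y1 - (x2 + a * y2)) := by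
    refine mul_left_cancel₀ hab ?_
    linear_combination h2
  have e3 : y1 * (c - a) = x0 + b * y0 - (x2 + b * y2) := by
    refine mul_left_cancel₀ hab ?_
    linear_combination -h3
  refine ⟨?_, ?_, ?_⟩
  · linear_combination -3 * e1 + e2 - e3
  · linear_combination (a + b + c) * e1 - b * e2 + a * e3
  · linear_combination (a * b + a * c + b * c) / 2 * e1
      + (a * c - (a * b + a * c + b * c) / 2) * e2 + ((a * b + a * c + b * c) / 2 - b * c) * e3

/-- The bracket equals `-wx ∂_x + (X p - wy p) ∂_y`. Its first component forces `c = -wx`, and the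
second then gives the homogeneity of `p`. -/
theorem dilatation_eq_of_symmetry {p : ℂ × ℂ → ℂ} {q : ℂ × ℂ} {wx wy : ℂ}
    (hp : DifferentiableAt ℂ p q)
    (h : ∃ c : ℂ, VectorField.lieBracket ℂ (dilatation wx wy) (fun z => (1, p z)) q
      = c • (1, p q)) :
    fderiv ℂ p q (dilatation wx wy q) = (wy - wx) * p q := by
  obtain ⟨c, hc⟩ := h
  have h1 : HasFDerivAt (fun z => ((1 : ℂ), p z)) ((0 : ℂ × ℂ →L[ℂ] ℂ).prod (fderiv ℂ p q)) q :=
    (hasFDerivAt_const _ _).prodMk hp.hasFDerivAt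
  have h2 : HasFDerivAt (dilatation wx wy)
      ((wx • ContinuousLinearMap.fst ℂ ℂ ℂ).prod (wy • ContinuousLinearMap.snd ℂ ℂ ℂ)) q :=
    ((wx • ContinuousLinearMap.fst ℂ ℂ ℂ).prod (wy • ContinuousLinearMap.snd ℂ ℂ ℂ)).hasFDerivAt
  rw [VectorField.lieBracket, h1.fderiv, h2.fderiv] at hc
  simp at hc
  obtain ⟨hc1, hc2⟩ := hc
  rw [← hc1] at hc2
  linear_combination hc2

/-- At the regular points of the web, the commuting idempotent fields and the symmetry yield the
differential equations for the coefficients of the cubic. -/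
theorem coefficient_equations {S A B : ℂ × ℂ → ℂ} {q : ℂ × ℂ} {p : Fin 3 → ℂ × ℂ → ℂ}
    {wx wy : ℂ} (hp : IsRootNumbering S A B q p)
    (hX : ∀ i, ∃ c : ℂ, VectorField.lieBracket ℂ (dilatation wx wy) (fun z => (1, p i z)) q
      = c • (1, p i q))
    (he : VectorField.lieBracket ℂ (idempotentField (p 0) (p 1) (p 2))
        (idempotentField (p 1) (p 2) (p 0)) (0, q) = 0) :
    2 * fderiv ℂ S q (1, 0) = fderiv ℂ A q (0, 1) ∧
    fderiv ℂ A q (1, 0) = 2 * fderiv ℂ B q (0, 1) ∧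
    -fderiv ℂ B q (1, 0) = A q * fderiv ℂ A q (0, 1) / 2
      - fderiv ℂ S q (0, 1) * B q - S q * fderiv ℂ B q (0, 1) ∧
    fderiv ℂ S q (dilatation wx wy q) = (wy - wx) * S q ∧
    fderiv ℂ A q (dilatation wx wy q) = 2 * (wy - wx) * A q ∧
    fderiv ℂ B q (dilatation wx wy q) = 3 * (wy - wx) * B q := by
  have hd := fun i => (hp.1 i).differentiableAt
  have hne : ∀ i j, i ≠ j → p i q - p j q ≠ 0 := fun i j hij h =>
    hij (hp.2.2 (sub_eq_zero.1 h))
  have hS : S q = -(p 0 q + p 1 q + p 2 q) := hp.eventuallyEq.1.eq_of_nhds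
  have hA : A q = p 0 q * p 1 q + p 0 q * p 2 q + p 1 q * p 2 q := hp.eventuallyEq.2.1.eq_of_nhds
  have hB : B q = -(p 0 q * p 1 q * p 2 q) := hp.eventuallyEq.2.2.eq_of_nhds
  have hE := fun i => dilatation_eq_of_symmetry (hd i) (hX i)
  obtain ⟨x1, x2, x3⟩ := hp.fderiv_eq (1, 0)
  obtain ⟨y1, y2, y3⟩ := hp.fderiv_eq (0, 1)
  obtain ⟨z1, z2, z3⟩ := hp.fderiv_eq (dilatation wx wy q)
  have hab := hne 0 1 (by decide)
  have hbc := hne 1 2 (by decide)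
  have hca := hne 2 0 (by decide)
  have hf : ∀ (i : Fin 3) (u : ℂ × ℂ), fderiv ℂ (p i) q u
      = u.1 * fderiv ℂ (p i) q (1, 0) + u.2 * fderiv ℂ (p i) q (0, 1) := by
    intro i u
    conv_lhs => rw [show u = u.1 • (1, 0) + u.2 • (0, 1) by ext <;> simp]
    simp only [map_add, map_smul, smul_eq_mul]
  -- The roots do not depend on `t`, so only the projection of the idempotent field to the plane
  -- differentiates them.
  have hV : ∀ (i : Fin 3) (a b c : ℂ × ℂ → ℂ),
      fderiv ℂ (p i) q (idempotentField a b c (0, q)).2 =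
        -1 / ((c q - a q) * (a q - b q)) *
          (fderiv ℂ (p i) q (1, 0) + a q * fderiv ℂ (p i) q (0, 1)) := by
    intro i a b c
    rw [hf]
    simp only [idempotentField]
    ring
  rw [VectorField.lieBracket, sub_eq_zero,
    fderiv_idempotentField_apply (z := (0, q)) (hd 1) (hd 2) (hd 0) hbc hab _ rfl rfl rfl
      (hV 1 _ _ _) (hV 2 _ _ _) (hV 0 _ _ _),
    fderiv_idempotentField_apply (z := (0, q)) (hd 0) (hd 1) (hd 2) hab hca _ rfl rfl rfl
      (hV 0 _ _ _) (hV 1 _ _ _) (hV 2 _ _ _)] at he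
  simp only [Prod.mk.injEq] at he
  obtain ⟨ht, hx, hy⟩ := he
  obtain ⟨k1, k2, k3⟩ := derivatives_of_commuting
    (a0 := fderiv ℂ (p 0) q (1, 0) + p 0 q * fderiv ℂ (p 0) q (0, 1))
    (a1 := fderiv ℂ (p 1) q (1, 0) + p 0 q * fderiv ℂ (p 1) q (0, 1))
    (a2 := fderiv ℂ (p 2) q (1, 0) + p 0 q * fderiv ℂ (p 2) q (0, 1))
    (b0 := fderiv ℂ (p 0) q (1, 0) + p 1 q * fderiv ℂ (p 0) q (0, 1))
    (b1 := fderiv ℂ (p 1) q (1, 0) + p 1 q * fderiv ℂ (p 1) q (0, 1))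
    (b2 := fderiv ℂ (p 2) q (1, 0) + p 1 q * fderiv ℂ (p 2) q (0, 1)) hab hbc hca
    (by linear_combination (norm := ring_nf) hx) (by linear_combination (norm := ring_nf) hy)
    (by linear_combination (norm := ring_nf) ht)
  obtain ⟨m1, m2, m3⟩ := coefficient_derivatives hab k1 k2 k3
  refine ⟨?_, ?_, ?_, ?_, ?_, ?_⟩
  · rw [x1, y2]; linear_combination m1
  · rw [x2, y3]; linear_combination m2
  · rw [x3, y2, y1, y3, hA, hS, hB]; linear_combination m3
  · rw [z1, hE, hE, hE, hS]; ring
  · rw [z2, hE, hE, hE, hA]; ring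
  · rw [z3, hE, hE, hE, hB]; ring

/-! ### Extension across the discriminant curve -/

/-- A continuous function that vanishes where a nonzero analytic function does not vanish is
zero. -/
theorem eq_zero_of_forall_ne_zero {E : Type*} [NormedAddCommGroup E] [NormedSpace ℂ E]
    {W : Set E} (hW : IsOpen W) (hWc : IsPreconnected W) {q₀ : E} (hq₀ : q₀ ∈ W) {D f : E → ℂ}
    (hD : AnalyticOnNhd ℂ D W) (hD0 : ∃ᶠ q in 𝓝 q₀, D q ≠ 0) (hf : ContinuousOn f W)
    (h : ∀ q ∈ W, D q ≠ 0 → f q = 0) {q : E} (hq : q ∈ W) : f q = 0 := by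
  by_contra hne
  have h1 : ∀ᶠ z in 𝓝 q, D z = 0 := by
    filter_upwards [hW.mem_nhds hq, (hf.continuousAt (hW.mem_nhds hq)).eventually_ne hne]
      with z hz hz'
    by_contra hDz
    exact hz' (h z hz hDz)
  -- If `f q ≠ 0`, then `D` vanishes near `q`, hence on all of `W` by the identity theorem, in
  -- particular near `q₀`.
  have h2 := hD.eqOn_zero_of_preconnected_of_eventuallyEq_zero hWc hq h1
  refine hD0 ?_
  filter_upwards [hW.mem_nhds hq₀] with z hz
  simpa using h2 hz

/-! ### Idempotents, semi-simplicity and the booklet web -/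

/-- `e` is a basis of orthogonal idempotents for the multiplication `cubicMul s a b`. -/
def IsCubicIdempotentFrame (s a b : ℂ) (e : Fin 3 → ℂ × ℂ × ℂ) : Prop :=
  LinearIndependent ℂ e ∧ ∀ i j, cubicMul s a b (e i) (e j) = if i = j then e i else 0

/-- The idempotent that takes the value `1` at the root `a` and `0` at the roots `b`, `c`. -/
def rootIdempotent (a b c : ℂ) : ℂ × ℂ × ℂ :=
  ((b * c - a * (b + c)) / (2 * ((a - b) * (a - c))), 1 / ((a - b) * (a - c)),
    a / ((a - b) * (a - c)))

theorem rootIdempotent_mul_self {a b c : ℂ} (hab : a ≠ b) (hac : a ≠ c) :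
    cubicMul (-(a + b + c)) (a * b + a * c + b * c) (-(a * b * c)) (rootIdempotent a b c)
      (rootIdempotent a b c) = rootIdempotent a b c := by
  have h1 := sub_ne_zero.2 hab
  have h2 := sub_ne_zero.2 hac
  simp only [cubicMul_apply, rootIdempotent]
  ext <;> simp only <;> field_simp <;> ring

theorem rootIdempotent_mul {a b c : ℂ} (hab : a ≠ b) (hac : a ≠ c) (hbc : b ≠ c) :
    cubicMul (-(a + b + c)) (a * b + a * c + b * c) (-(a * b * c)) (rootIdempotent a b c)
      (rootIdempotent b c a) = 0 := by
  have h1 := sub_ne_zero.2 hab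
  have h2 := sub_ne_zero.2 hac
  have h3 := sub_ne_zero.2 hbc
  have h4 := sub_ne_zero.2 hab.symm
  simp only [cubicMul_apply, rootIdempotent]
  ext <;> simp only [Prod.fst_zero, Prod.snd_zero] <;> field_simp <;> ring

theorem rootIdempotent_ne_zero {a b c : ℂ} (hab : a ≠ b) (hac : a ≠ c) :
    rootIdempotent a b c ≠ 0 := by
  intro h
  have h1 := congrArg (fun u : ℂ × ℂ × ℂ => u.2.1) h
  simp [rootIdempotent, sub_eq_zero, hab, hac] at h1

theorem cubicMul_comm (s a b : ℂ) (u v : ℂ × ℂ × ℂ) : cubicMul s a b u v = cubicMul s a b v u := by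
  simp only [cubicMul_apply]; ext <;> simp only <;> ring

/-- Three distinct roots yield a basis of idempotents. -/
theorem isCubicIdempotentFrame_of_roots {a b c : ℂ} (hab : a ≠ b) (hac : a ≠ c) (hbc : b ≠ c) :
    IsCubicIdempotentFrame (-(a + b + c)) (a * b + a * c + b * c) (-(a * b * c))
      ![rootIdempotent a b c, rootIdempotent b c a, rootIdempotent c a b] := by
  -- The coefficients are invariant under cyclic permutations of the roots, so one square and one
  -- product, together with commutativity, give the whole multiplication table.
  have e1 : -(b + c + a) = -(a + b + c) := by ring
  have e2 : b * c + b * a + c * a = a * b + a * c + b * c := by ring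
  have e3 : -(b * c * a) = -(a * b * c) := by ring
  have e4 : -(c + a + b) = -(a + b + c) := by ring
  have e5 : c * a + c * b + a * b = a * b + a * c + b * c := by ring
  have e6 : -(c * a * b) = -(a * b * c) := by ring
  have s0 := rootIdempotent_mul_self hab hac
  have s1 := rootIdempotent_mul_self hbc hab.symm
  have s2 := rootIdempotent_mul_self hac.symm hbc.symm
  have m0 := rootIdempotent_mul hab hac hbc
  have m1 := rootIdempotent_mul hbc hab.symm hac.symm
  have m2 := rootIdempotent_mul hac.symm hbc.symm hab
  rw [e1, e2, e3] at s1 m1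
  rw [e4, e5, e6] at s2 m2
  have n0 := cubicMul_comm _ _ _ _ _ ▸ m0
  have n1 := cubicMul_comm _ _ _ _ _ ▸ m1
  have n2 := cubicMul_comm _ _ _ _ _ ▸ m2
  have hmul : ∀ i j, cubicMul (-(a + b + c)) (a * b + a * c + b * c) (-(a * b * c))
      (![rootIdempotent a b c, rootIdempotent b c a, rootIdempotent c a b] i)
      (![rootIdempotent a b c, rootIdempotent b c a, rootIdempotent c a b] j) =
        if i = j then ![rootIdempotent a b c, rootIdempotent b c a, rootIdempotent c a b] i
        else 0 := by
    intro i j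
    fin_cases i <;> fin_cases j
    exacts [s0, m0, n2, n0, s1, m1, m2, n1, s2]
  refine ⟨?_, hmul⟩
  rw [Fintype.linearIndependent_iff]
  intro g hg j
  -- Multiplying a linear relation by the `j`-th idempotent leaves only its `j`-th term.
  have h := congrArg (cubicMul (-(a + b + c)) (a * b + a * c + b * c) (-(a * b * c))
    (![rootIdempotent a b c, rootIdempotent b c a, rootIdempotent c a b] j)) hg
  simp only [map_sum, map_smul, hmul, smul_ite, smul_zero, Finset.sum_ite_eq, Finset.mem_univ,
    if_true, map_zero] at h
  refine (smul_eq_zero.1 h).resolve_right ?_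
  fin_cases j
  · exact rootIdempotent_ne_zero hab hac
  · exact rootIdempotent_ne_zero hbc hab.symm
  · exact rootIdempotent_ne_zero hac.symm hbc.symm

/-- The idempotents of `cubicMul s a b` are, up to scale, the eigenvectors of the multiplication by
`∂_y`, and the eigenvalues are the three roots of the cubic. -/
theorem IsCubicIdempotentFrame.exists_roots {s a b : ℂ} {e : Fin 3 → ℂ × ℂ × ℂ}
    (h : IsCubicIdempotentFrame s a b e) :
    ∃ (r k : Fin 3 → ℂ), (∀ i, k i ≠ 0) ∧
      (∀ i, e i = k i • (r i ^ 2 + s * r i + a / 2, 1, r i)) ∧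
      r 0 ≠ r 1 ∧ r 0 ≠ r 2 ∧ r 1 ≠ r 2 ∧
      s = -(r 0 + r 1 + r 2) ∧ a = r 0 * r 1 + r 0 * r 2 + r 1 * r 2 ∧
      b = -(r 0 * r 1 * r 2) := by
  obtain ⟨hli, hmul⟩ := h
  have hspan := hli.span_eq_top_of_card_eq_finrank (by simp)
  -- The coordinates of `∂_y` in the idempotent basis are the eigenvalues of multiplication by
  -- `∂_y`.
  obtain ⟨r, hr⟩ := (Submodule.mem_span_range_iff_exists_fun ℂ).1
    (hspan ▸ Submodule.mem_top : ((0, 0, 1) : ℂ × ℂ × ℂ) ∈ Submodule.span ℂ (Set.range e))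
  have heig : ∀ i, cubicMul s a b (e i) (0, 0, 1) = r i • e i := by
    intro i
    rw [← hr]
    simp [map_sum, map_smul, hmul]
  have hcomp : ∀ i, -b * (e i).2.1 - a / 2 * (e i).2.2 = r i * (e i).1 ∧
      (e i).2.2 = r i * (e i).2.1 ∧
      (e i).1 - s * (e i).2.2 - a / 2 * (e i).2.1 = r i * (e i).2.2 := by
    intro i
    have h1 := heig i
    rw [cubicMul_apply, Prod.ext_iff, Prod.ext_iff] at h1
    simpa using h1
  have hk : ∀ i, (e i).2.1 ≠ 0 := by
    intro i hi
    obtain ⟨-, h2, h3⟩ := hcomp i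
    have h4 : (e i).2.2 = 0 := by rw [h2, hi, mul_zero]
    have h5 : (e i).1 = 0 := by rw [hi, h4] at h3; simpa using h3
    exact hli.ne_zero i (Prod.ext h5 (Prod.ext hi h4))
  have hform : ∀ i, e i = (e i).2.1 • (r i ^ 2 + s * r i + a / 2, 1, r i) := by
    intro i
    obtain ⟨-, h2, h3⟩ := hcomp i
    refine Prod.ext ?_ (Prod.ext ?_ ?_)
    · simp only [Prod.smul_fst, smul_eq_mul]
      linear_combination h3 + (s + r i) * h2
    · simp
    · simp only [Prod.smul_snd, smul_eq_mul]
      linear_combination h2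
  have hroot : ∀ i, r i ^ 3 + s * r i ^ 2 + a * r i + b = 0 := by
    intro i
    obtain ⟨h1, h2, h3⟩ := hcomp i
    refine mul_left_cancel₀ (hk i) ?_
    linear_combination -h1 - r i * h3 - (a / 2 + r i * s + r i ^ 2) * h2
  -- By `hform`, equal eigenvalues would make `e i` and `e j` proportional; multiplying by `e i`
  -- preserves the first and kills the second.
  have hne : ∀ i j, i ≠ j → r i ≠ r j := by
    intro i j hij hrij
    have h1 : (e j).2.1 • e i = (e i).2.1 • e j := by
      rw [hform i, hform j, hrij, smul_smul, smul_smul]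
      simp [mul_comm]
    have h2 := congrArg (cubicMul s a b (e i)) h1
    rw [map_smul, map_smul, hmul, hmul, if_pos rfl, if_neg hij, smul_zero] at h2
    exact (smul_eq_zero.1 h2).elim (hk j) (hli.ne_zero i)
  have h01 := hne 0 1 (by decide)
  have h02 := hne 0 2 (by decide)
  have h12 := hne 1 2 (by decide)
  -- Vieta's formulas by divided differences: `q1` and `q2` are first ones, `hs` a second one.
  have q1 : r 0 ^ 2 + r 0 * r 1 + r 1 ^ 2 + s * (r 0 + r 1) + a = 0 := by
    refine mul_left_cancel₀ (sub_ne_zero.2 h01) ?_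
    linear_combination hroot 0 - hroot 1
  have q2 : r 0 ^ 2 + r 0 * r 2 + r 2 ^ 2 + s * (r 0 + r 2) + a = 0 := by
    refine mul_left_cancel₀ (sub_ne_zero.2 h02) ?_
    linear_combination hroot 0 - hroot 2
  have hs : s = -(r 0 + r 1 + r 2) := by
    refine mul_left_cancel₀ (sub_ne_zero.2 h12) ?_
    linear_combination q1 - q2
  have ha : a = r 0 * r 1 + r 0 * r 2 + r 1 * r 2 := by
    linear_combination q1 - (r 0 + r 1) * hs
  exact ⟨r, fun i => (e i).2.1, hk, hform, h01, h02, h12, hs, ha, by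
    linear_combination hroot 0 - r 0 ^ 2 * hs - r 0 * ha⟩

theorem exists_isCubicIdempotentFrame_iff (S A B : ℂ × ℂ → ℂ) (q : ℂ × ℂ) :
    (∃ e, IsCubicIdempotentFrame (S q) (A q) (B q) e) ↔ (odeCubic S A B q).discr ≠ 0 := by
  constructor
  · rintro ⟨e, he⟩
    obtain ⟨r, -, -, -, h01, h02, h12, hS, hA, hB⟩ := he.exists_roots
    rw [discr_odeCubic_eq hS hA hB]
    simp [sub_eq_zero, h01, h02, h12]
  · intro hD
    obtain ⟨a, b, c, hab, hac, hbc, hS, hA, hB⟩ := exists_eq_of_discr_ne_zero S A B q hD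
    rw [hS, hA, hB]
    exact ⟨_, isCubicIdempotentFrame_of_roots hab hac hbc⟩

theorem IsCubicIdempotentFrame.mem_span_iff {S A B : ℂ × ℂ → ℂ} {q : ℂ × ℂ}
    {e : Fin 3 → ℂ × ℂ × ℂ} (he : IsCubicIdempotentFrame (S q) (A q) (B q) e) (v : ℂ × ℂ) :
    (v ≠ 0 ∧ ∃ i, ((0, v) : ℂ × ℂ × ℂ) ∈ Submodule.span ℂ {(1, 0, 0), e i}) ↔
      IsSolutionDirection S A B q v := by
  obtain ⟨r, k, hk, hform, -, -, -, hS, hA, hB⟩ := he.exists_roots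
  have hmem : ∀ i, ((0, v) : ℂ × ℂ × ℂ) ∈ Submodule.span ℂ {(1, 0, 0), e i} ↔
      v.2 - r i * v.1 = 0 := by
    intro i
    rw [Submodule.mem_span_pair, hform i]
    constructor
    · rintro ⟨α, β, h⟩
      rw [Prod.ext_iff, Prod.ext_iff] at h
      simp at h
      obtain ⟨-, h1, h2⟩ := h
      rw [← h1, ← h2]
      ring
    · intro h
      -- The multiple `v.1 / k i` of `e i` has the right `x`- and `y`-components, and the multiple
      -- of `∂_t` cancels its `t`-component.
      refine ⟨-(v.1 * (r i ^ 2 + S q * r i + A q / 2)), v.1 / k i, ?_⟩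
      have := hk i
      refine Prod.ext ?_ (Prod.ext ?_ ?_)
      · simp
        field_simp
        ring
      · simp
        field_simp
      · simp
        field_simp
        linear_combination -h
  have hfac : v.2 ^ 3 + S q * v.2 ^ 2 * v.1 + A q * v.2 * v.1 ^ 2 + B q * v.1 ^ 3
      = (v.2 - r 0 * v.1) * (v.2 - r 1 * v.1) * (v.2 - r 2 * v.1) := by
    rw [hS, hA, hB]; ring
  simp only [IsSolutionDirection, hmem, hfac, Fin.exists_fin_succ, mul_eq_zero]
  simp [or_assoc]

end

/-! ### Assembly of the germ -/

theorem mainTheorem1 (S A B : ℂ × ℂ → ℂ) (q₀ : ℂ × ℂ) (wx wy : ℂ)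
    (hS : AnalyticAt ℂ S q₀) (hA : AnalyticAt ℂ A q₀) (hB : AnalyticAt ℂ B q₀)
    -- the discriminant does not vanish identically as a germ
    (hD : ∃ᶠ q in 𝓝 q₀, (odeCubic S A B q).discr ≠ 0)
    (hw : wx ≠ wy)
    -- the dilatation is an infinitesimal symmetry
    (hX : IsInfinitesimalSymmetry S A B q₀ (dilatation wx wy))
    -- the Chern connection form vanishes identically
    (hγ : ∀ᶠ q in 𝓝 q₀, ∀ p, IsRootNumbering S A B q p → chernForm p q = 0)
    -- the fields `e₁` and `e₂` commute
    (he : ∀ᶠ q in 𝓝 q₀, ∀ p, IsRootNumbering S A B q p → ∀ t : ℂ,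
      VectorField.lieBracket ℂ (idempotentField (p 0) (p 1) (p 2))
        (idempotentField (p 1) (p 2) (p 0)) (t, q) = 0) :
    ∃ (U : Set (ℂ × ℂ × ℂ)) (F : FrobeniusStructure U) (φ : ℂ × ℂ → ℂ × ℂ × ℂ),
      (∀ z ∈ U, F.metric z (F.unit z) (F.unit z) = 0) ∧
      IsBookletWeb F φ S A B q₀ ∧
      -- the Euler field projects along `e` onto the dilatation
      ∀ᶠ q in 𝓝 q₀, ∃ c : ℂ,
        F.euler (φ q) = fderiv ℂ φ q (dilatation wx wy q) + c • F.unit (φ q) := by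
  -- A ball is used for its connectedness, which the identity theorem needs.
  obtain ⟨ε, hε, hball⟩ := Metric.eventually_nhds_iff_ball.1
    (hS.eventually_analyticAt.and (hA.eventually_analyticAt.and
      (hB.eventually_analyticAt.and (hX.and he))))
  set W := Metric.ball q₀ ε
  have hW : IsOpen W := Metric.isOpen_ball
  have hWc : IsPreconnected W := (convex_ball q₀ ε).isPreconnected
  have hq₀ : q₀ ∈ W := Metric.mem_ball_self hε
  have hSW : AnalyticOnNhd ℂ S W := fun q hq => (hball q hq).1
  have hAW : AnalyticOnNhd ℂ A W := fun q hq => (hball q hq).2.1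
  have hBW : AnalyticOnNhd ℂ B W := fun q hq => (hball q hq).2.2.1
  have hDW : AnalyticOnNhd ℂ (fun q => (odeCubic S A B q).discr) W := by
    intro q hq
    have := hSW q hq
    have := hAW q hq
    have := hBW q hq
    simp only [odeCubic, Cubic.discr]
    fun_prop
  have key := fun (q : ℂ × ℂ) (hq : q ∈ W) (hDq : (odeCubic S A B q).discr ≠ 0) =>
    have hp := (exists_isRootNumbering (hSW q hq) (hAW q hq) (hBW q hq) hDq).choose_spec
    coefficient_equations hp ((hball q hq).2.2.2.1 _ hp) ((hball q hq).2.2.2.2 _ hp 0)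
  have hdil : Continuous (dilatation wx wy) := by unfold dilatation; fun_prop
  have cS := hSW.continuousOn
  have cA := hAW.continuousOn
  have cB := hBW.continuousOn
  have dS := hSW.fderiv.continuousOn
  have dA := hAW.fderiv.continuousOn
  have dB := hBW.fderiv.continuousOn
  have ext : ∀ {f : ℂ × ℂ → ℂ}, ContinuousOn f W →
      (∀ q ∈ W, (odeCubic S A B q).discr ≠ 0 → f q = 0) → ∀ q ∈ W, f q = 0 :=
    fun hf h q hq => eq_zero_of_forall_ne_zero hW hWc hq₀ hDW hD hf h hq
  let F := cubicFrobenius S A B wx wy W hW hSW hAW hBW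
    (fun q hq => sub_eq_zero.1 (ext
      (f := fun q => 2 * fderiv ℂ S q (1, 0) - fderiv ℂ A q (0, 1)) (by fun_prop)
      (fun q hq h => sub_eq_zero.2 (key q hq h).1) q hq))
    (fun q hq => sub_eq_zero.1 (ext
      (f := fun q => fderiv ℂ A q (1, 0) - 2 * fderiv ℂ B q (0, 1)) (by fun_prop)
      (fun q hq h => sub_eq_zero.2 (key q hq h).2.1) q hq))
    (fun q hq => sub_eq_zero.1 (ext
      (f := fun q => -fderiv ℂ B q (1, 0) - (A q * fderiv ℂ A q (0, 1) / 2
        - fderiv ℂ S q (0, 1) * B q - S q * fderiv ℂ B q (0, 1))) (by fun_prop)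
      (fun q hq h => sub_eq_zero.2 (key q hq h).2.2.1) q hq))
    (fun q hq => sub_eq_zero.1 (ext
      (f := fun q => fderiv ℂ S q (dilatation wx wy q) - (wy - wx) * S q) (by fun_prop)
      (fun q hq h => sub_eq_zero.2 (key q hq h).2.2.2.1) q hq))
    (fun q hq => sub_eq_zero.1 (ext
      (f := fun q => fderiv ℂ A q (dilatation wx wy q) - 2 * (wy - wx) * A q) (by fun_prop)
      (fun q hq h => sub_eq_zero.2 (key q hq h).2.2.2.2.1) q hq))
    (fun q hq => sub_eq_zero.1 (ext
      (f := fun q => fderiv ℂ B q (dilatation wx wy q) - 3 * (wy - wx) * B q) (by fun_prop)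
      (fun q hq h => sub_eq_zero.2 (key q hq h).2.2.2.2.2) q hq))
  have hφ : ∀ q, fderiv ℂ (ContinuousLinearMap.inr ℂ ℂ (ℂ × ℂ)) q
      = ContinuousLinearMap.inr ℂ ℂ (ℂ × ℂ) := fun q => ContinuousLinearMap.fderiv _
  -- The surface is the slice `t = 0`, parametrized by `q ↦ (0, q)`.
  refine ⟨_, F, ContinuousLinearMap.inr ℂ ℂ (ℂ × ℂ), ?_, ⟨hq₀, ?_, ?_, ?_, ?_⟩, ?_⟩
  · intro z _
    change flatMetric (1, 0, 0) (1, 0, 0) = 0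
    simp
  · exact ContinuousLinearMap.analyticAt _ _
  · rw [hφ]
    intro u v huv
    simpa using huv
  · rw [hφ]
    rintro ⟨u, hu⟩
    exact zero_ne_one (congrArg Prod.fst hu)
  · refine Eventually.of_forall fun q => ⟨exists_isCubicIdempotentFrame_iff S A B q, ?_⟩
    intro e hframe v
    rw [hφ]
    exact IsCubicIdempotentFrame.mem_span_iff (e := e) hframe v
  -- The `t`-component of the Euler field is a multiple of `t`, so on this slice the field is
  -- tangent and no multiple of `∂_t` has to be added.
  · refine Eventually.of_forall fun q => ⟨0, ?_⟩
    rw [hφ, zero_smul, add_zero]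
    change diagonalMap (2 * wy - wx) wx wy (0, q) = (0, dilatation wx wy q)
    simp [dilatation]
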